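/- Let $G$ be a finite simple planar graph (that is, $G$ can be drawn in the plane $\mathbb{R}^2$ with vertices as distinct points and edges as simple continuous arcs joining their ends, without crossings) of girth at least $8$, i.e. every cycle of $G$ has length at least $8$ (forests are included). A correspondence-cover of $G$ is a pair $(L,H)$ where $H$ is a graph and $L\colon V(G)\to 2^{V(H)}$ is such that: the sets $L(v)$, $v\in V(G)$, partition $V(H)$; each $L(v)$ is a clique of $H$; for distinct $u,v$ with $uv\notin E(G)$ there is no edge of $H$ between $L(u)$ and $L(v)$; and for $uv\in E(G)$ the edges of $H$ between $L(u)$ and $L(v)$ form a (possibly empty, not necessarily perfect) matching. It is $3$-fold if $|L(v)|=3$ for every $v\in V(G)$. A proper correspondence-coloring of $(L,H)$ is an independent set of $H$ that contains precisely one vertex of $L(v)$ for every $v\in V(G)$. Then every $3$-fold correspondence-cover $(L,H)$ of $G$ admits two disjoint proper correspondence-colorings; that is, there are two independent sets $I,J$ of $H$ with $I\cap J=\emptyset$, each containing precisely one vertex of $L(v)$ for every $v\in V(G)$. -/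

import Mathlib

/-- A drawing of the graph `G` in the plane `ℝ²` without crossings: distinct vertices are distinct
points, every edge `uv` is a simple (continuous) arc between the points of `u` and `v`, the interior
of an edge contains no vertex, and the interiors of distinct edges are disjoint. The two orientations
(darts) of an edge carry the same arc, traversed in opposite directions. -/
structure PlaneDrawing {V : Type*} (G : SimpleGraph V) where
  /-- the point representing a vertex -/
  point : V → ℝ × ℝ
  /-- the arc representing an (oriented) edge -/
  arc : (d : G.Dart) → Path (point d.fst) (point d.snd)
  point_injective : Function.Injective point
  arc_injective : ∀ d : G.Dart, Function.Injective (arc d)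
  arc_symm : ∀ d : G.Dart, arc d.symm = (arc d).symm
  arc_ne_point : ∀ (d : G.Dart) (t : unitInterval), t ≠ 0 → t ≠ 1 → ∀ v : V, arc d t ≠ point v
  arc_ne_arc : ∀ d d' : G.Dart, d.edge ≠ d'.edge → ∀ s t : unitInterval,
    s ≠ 0 → s ≠ 1 → t ≠ 0 → t ≠ 1 → arc d s ≠ arc d' t

/-- A graph is planar if it can be drawn in the plane without crossings. -/
def IsPlanarGraph {V : Type*} (G : SimpleGraph V) : Prop :=
  Nonempty (PlaneDrawing G)

/-- A correspondence-cover `(L, H)` of the graph `G`, where `W` is the vertex set of `H`. -/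
structure CorrespondenceCover {V : Type*} (G : SimpleGraph V) (W : Type*) where
  /-- the cover graph -/
  H : SimpleGraph W
  /-- the lists -/
  L : V → Set W
  /-- the lists partition the vertex set of `H` -/
  existsUnique_mem : ∀ x : W, ∃! v : V, x ∈ L v
  /-- there are no edges of `H` between the lists of distinct non-adjacent vertices -/
  not_adj : ∀ u v : V, u ≠ v → ¬ G.Adj u v → ∀ x ∈ L u, ∀ y ∈ L v, ¬ H.Adj x y
  /-- the edges of `H` between the lists of two adjacent vertices form a (possibly empty, not
  necessarily perfect) matching; uniqueness on the other side follows by exchanging `u` and `v` -/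
  matching : ∀ u v : V, G.Adj u v → ∀ x ∈ L u, ∀ y ∈ L v, ∀ y' ∈ L v,
    H.Adj x y → H.Adj x y' → y = y'
  /-- each list is a clique of `H` -/
  isClique : ∀ v : V, H.IsClique (L v)

/-- A correspondence-cover is `k`-fold if all its lists have exactly `k` elements. -/
def CorrespondenceCover.IsFold {V W : Type*} {G : SimpleGraph V} (C : CorrespondenceCover G W)
    (k : ℕ) : Prop :=
  ∀ v : V, (C.L v).encard = k

/-- A (proper) correspondence-coloring of a cover `(L, H)`, given by its set of chosen colors: an
independent set of `H` that contains precisely one vertex of each list. -/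
def CorrespondenceCover.IsColoring {V W : Type*} {G : SimpleGraph V} (C : CorrespondenceCover G W)
    (I : Set W) : Prop :=
  C.H.IsIndepSet I ∧ ∀ v : V, ∃! x : W, x ∈ I ∧ x ∈ C.L v

/-! Two disjoint colorings together give every vertex a state: one of the 6 ordered pairs of
distinct colors. A state excludes at most 3 states of a neighbour, and through a middle vertex at
most one state at distance two, essentially the swapped pair. Since 3 + 1 + 1 < 6, a solution
extends across a vertex of degree at most 1, across two adjacent vertices of degree 2, and across a
vertex of degree 3 with two nonadjacent neighbours of degree 2. Discharging
(`reducibleConfig_of_card_edges_lt`) finds such a configuration when 3|E| < 4|V|. Induced subgraphs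
inherit planarity and girth, so induction on the vertex set works once this sparsity is known.

Sparsity comes from 𝔽₂-duality, without the Jordan curve theorem. A drawing is replaced by a minor
of a fine square grid (`PlaneDrawing.nonempty_gridMinor`), whose faces are classes of grid cells.
Closed chains of the grid are coboundaries of cells (`exists_cellDiff_of_gridBoundary`), so the
cycle space of the graph is the cut space of the multigraph of faces. Hence it has a basis of face
stars. Each edge lies in at most two of them and, by the girth, each has at least 8 edges; so the
dimension is at most |E|/4. It is also at least |E| - |V| + 1, which gives 3|E| + 4 ≤ 4|V|. -/

/-! ### Constraint systems with six states and their reducible configurations. -/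

/-- Compatibility relations between the states of adjacent vertices, such that a state excludes at
most three states of a neighbour and, through a middle vertex, at most one state at distance two. -/
structure ConstraintSystem {V : Type*} (G : SimpleGraph V) (S : Type*) where
  /-- compatibility of the states of two vertices -/
  rel : V → V → S → S → Prop
  symm : ∀ u v x y, rel u v x y → rel v u y x
  ncard_excluded : ∀ u v, G.Adj u v → ∀ x, {y | ¬ rel u v x y}.ncard ≤ 3
  ncard_unreachable : ∀ u v w, G.Adj u v → G.Adj v w → ∀ x,
    {z | ¬ ∃ y, rel u v x y ∧ rel v w y z}.ncard ≤ 1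

/-- The local configurations across which every solution of a constraint system extends. -/
inductive ReducibleConfig {V : Type*} (G : SimpleGraph V) : Prop
  | leaf (v : V) (h : ∀ x y, G.Adj v x → G.Adj v y → x = y)
  | pair (v₁ v₂ u w : V) (h : G.Adj v₁ v₂) (hu : G.Adj v₁ u) (hw : G.Adj v₂ w)
      (h₁ : ∀ x, G.Adj v₁ x → x = u ∨ x = v₂)
      (h₂ : ∀ x, G.Adj v₂ x → x = w ∨ x = v₁)
  | star (v v₁ v₂ u w₁ w₂ : V) (hv₁ : G.Adj v v₁) (hv₂ : G.Adj v v₂) (hu : G.Adj v u)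
      (hw₁ : G.Adj v₁ w₁) (hw₂ : G.Adj v₂ w₂) (hn : ¬ G.Adj v₁ v₂)
      (h : ∀ x, G.Adj v x → x = v₁ ∨ x = v₂ ∨ x = u)
      (h₁ : ∀ x, G.Adj v₁ x → x = v ∨ x = w₁) (h₂ : ∀ x, G.Adj v₂ x → x = v ∨ x = w₂)

namespace ConstraintSystem

variable {V S : Type*} {G : SimpleGraph V}

/-- The constraint system can be solved on the vertices of `s`. -/
def SolvableOn (C : ConstraintSystem G S) (s : Set V) : Prop :=
  ∃ f : V → S, ∀ u ∈ s, ∀ v ∈ s, G.Adj u v → C.rel u v (f u) (f v)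

theorem exists_notMem_of_ncard (hS : Nat.card S = 6) (A B D : Set S)
    (h : A.ncard + B.ncard + D.ncard < 6) : ∃ z, z ∉ A ∧ z ∉ B ∧ z ∉ D := by
  have : Finite S := Nat.finite_of_card_ne_zero (by omega)
  by_contra! hc
  have hu : A ∪ B ∪ D = Set.univ := by
    ext z
    simp only [Set.mem_union, Set.mem_univ, iff_true]
    by_cases hA : z ∈ A
    · exact .inl (.inl hA)
    · by_cases hB : z ∈ B
      · exact .inl (.inr hB)
      · exact .inr (hc z hA hB)
  have h₁ := Set.ncard_union_le (A ∪ B) D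
  have h₂ := Set.ncard_union_le A B
  rw [hu, Set.ncard_univ, hS] at h₁
  omega

/-- Extending a solution to a vertex all of whose neighbours are solved compatibly. -/
theorem extend {C : ConstraintSystem G S} {s : Set V} {f : V → S} {v : V} {z : S}
    (hf : ∀ a ∈ s, ∀ b ∈ s, G.Adj a b → C.rel a b (f a) (f b))
    (hz : ∀ x ∈ s, G.Adj v x → x ≠ v → C.rel v x z (f x)) [DecidableEq V] :
    ∀ a ∈ insert v s, ∀ b ∈ insert v s, G.Adj a b →
      C.rel a b (Function.update f v z a) (Function.update f v z b) := by
  intro a ha b hb hab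
  by_cases hav : a = v
  · subst hav
    rw [Function.update_self, Function.update_of_ne hab.ne']
    exact hz b (hb.resolve_left hab.ne') hab hab.ne'
  · by_cases hbv : b = v
    · subst hbv
      rw [Function.update_self, Function.update_of_ne hab.ne]
      exact C.symm _ _ _ _ (hz a (ha.resolve_left hab.ne) hab.symm hab.ne)
    · rw [Function.update_of_ne hav, Function.update_of_ne hbv]
      exact hf a (ha.resolve_left hav) b (hb.resolve_left hbv) hab

theorem SolvableOn.leaf {C : ConstraintSystem G S} (hS : Nat.card S = 6) {s : Set V} {v : V}
    (hv : v ∈ s) (h : ∀ x ∈ s, ∀ y ∈ s, G.Adj v x → G.Adj v y → x = y)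
    (hC : C.SolvableOn (s \ {v})) : C.SolvableOn s := by
  classical
  obtain ⟨f, hf⟩ := hC
  obtain ⟨z, hz⟩ : ∃ z, ∀ x ∈ s, G.Adj v x → C.rel v x z (f x) := by
    by_cases hx : ∃ x ∈ s, G.Adj v x
    · obtain ⟨x, hxs, hx⟩ := hx
      obtain ⟨z, hz, -, -⟩ := exists_notMem_of_ncard hS {y | ¬ C.rel x v (f x) y} ∅ ∅ (by
        have := C.ncard_excluded x v hx.symm (f x)
        simp only [Set.ncard_empty]
        omega)
      refine ⟨z, fun y hys hy => ?_⟩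
      rw [h y hys x hxs hy hx]
      exact C.symm _ _ _ _ (by simpa using hz)
    · exact ⟨f v, fun x hxs hx' => (hx ⟨x, hxs, hx'⟩).elim⟩
  have e := extend (v := v) (z := z) hf (fun x hx hx' _ => hz x hx.1 hx')
  rw [Set.insert_sdiff_singleton, Set.insert_eq_of_mem hv] at e
  exact ⟨_, e⟩

/-- The state of `v₂` must avoid at most 3 states because of `w`, and at most 1 that cannot be
reached from `u` through `v₁`; 3 + 1 < 6. The state of `v₁` is then a witness of reachability. -/
theorem SolvableOn.pair {C : ConstraintSystem G S} (hS : Nat.card S = 6) {s : Set V}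
    {v₁ v₂ u w : V} (h : G.Adj v₁ v₂) (hu : G.Adj v₁ u) (hw : G.Adj v₂ w)
    (h₁ : ∀ x ∈ s, G.Adj v₁ x → x = u ∨ x = v₂) (h₂ : ∀ x ∈ s, G.Adj v₂ x → x = w ∨ x = v₁)
    (hC : C.SolvableOn (s \ {v₁, v₂})) : C.SolvableOn s := by
  classical
  obtain ⟨f, hf⟩ := hC
  obtain ⟨z, hz, hz', -⟩ := exists_notMem_of_ncard hS
    {z | ¬ ∃ y, C.rel u v₁ (f u) y ∧ C.rel v₁ v₂ y z} {z | ¬ C.rel w v₂ (f w) z} ∅ (by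
      have h₁ := C.ncard_excluded w v₂ hw.symm (f w)
      have h₂ := C.ncard_unreachable u v₁ v₂ hu.symm h (f u)
      simp only [Set.ncard_empty]
      omega)
  simp only [Set.mem_ofPred_eq, not_not] at hz hz'
  obtain ⟨y, hy₁, hy₂⟩ := hz
  have e₁ := extend (v := v₂) (z := z) hf (fun x hx hx' _ => by
    rcases h₂ x hx.1 hx' with rfl | rfl
    · exact C.symm _ _ _ _ hz'
    · exact (hx.2 (by simp)).elim)
  have e₂ := extend (v := v₁) (z := y) e₁ (fun x hx hx' _ => by
    by_cases hx₂ : x = v₂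
    · subst hx₂
      rw [Function.update_self]
      exact hy₂
    · rw [Function.update_of_ne hx₂]
      rcases h₁ x (hx.resolve_left hx₂).1 hx' with rfl | rfl
      · exact C.symm _ _ _ _ hy₁
      · exact (hx₂ rfl).elim)
  refine ⟨_, fun a ha b hb => e₂ a ?_ b ?_⟩ <;> simp only [Set.mem_insert_iff, Set.mem_sdiff,
    Set.mem_singleton_iff] <;> tauto

/-- The centre avoids at most 3 states because of `u` and at most 1 for each of the paths through
`v₁` and `v₂`; 3 + 1 + 1 < 6. The states of `v₁` and `v₂` are filled in afterwards, independently
since these are not adjacent. -/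
theorem SolvableOn.star {C : ConstraintSystem G S} (hS : Nat.card S = 6) {s : Set V}
    {v v₁ v₂ u w₁ w₂ : V} (hv₁ : G.Adj v v₁) (hv₂ : G.Adj v v₂) (hu : G.Adj v u)
    (hw₁ : G.Adj v₁ w₁) (hw₂ : G.Adj v₂ w₂) (hn : ¬ G.Adj v₁ v₂)
    (h : ∀ x ∈ s, G.Adj v x → x = v₁ ∨ x = v₂ ∨ x = u)
    (h₁ : ∀ x ∈ s, G.Adj v₁ x → x = v ∨ x = w₁) (h₂ : ∀ x ∈ s, G.Adj v₂ x → x = v ∨ x = w₂)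
    (hC : C.SolvableOn (s \ {v, v₁, v₂})) : C.SolvableOn s := by
  classical
  obtain ⟨f, hf⟩ := hC
  obtain ⟨z, hz, hz₁, hz₂⟩ := exists_notMem_of_ncard hS {z | ¬ C.rel u v (f u) z}
    {z | ¬ ∃ y, C.rel w₁ v₁ (f w₁) y ∧ C.rel v₁ v y z}
    {z | ¬ ∃ y, C.rel w₂ v₂ (f w₂) y ∧ C.rel v₂ v y z} (by
      have := C.ncard_excluded u v hu.symm (f u)
      have := C.ncard_unreachable w₁ v₁ v hw₁.symm hv₁.symm (f w₁)
      have := C.ncard_unreachable w₂ v₂ v hw₂.symm hv₂.symm (f w₂)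
      omega)
  simp only [Set.mem_ofPred_eq, not_not] at hz hz₁ hz₂
  obtain ⟨y₁, hy₁, hy₁'⟩ := hz₁
  obtain ⟨y₂, hy₂, hy₂'⟩ := hz₂
  have e := extend (v := v) (z := z) hf (fun x hx hx' _ => by
    rcases h x hx.1 hx' with rfl | rfl | rfl
    · exact (hx.2 (by simp)).elim
    · exact (hx.2 (by simp)).elim
    · exact C.symm _ _ _ _ hz)
  have e₁ := extend (v := v₁) (z := y₁) e (fun x hx hx' _ => by
    by_cases hxv : x = v
    · subst hxv
      rw [Function.update_self]
      exact hy₁'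
    · rw [Function.update_of_ne hxv]
      rcases h₁ x (hx.resolve_left hxv).1 hx' with rfl | rfl
      · exact (hxv rfl).elim
      · exact C.symm _ _ _ _ hy₁)
  have e₂ := extend (v := v₂) (z := y₂) e₁ (fun x hx hx' _ => by
    have hx₁ : x ≠ v₁ := by
      rintro rfl
      exact hn hx'.symm
    rw [Function.update_of_ne hx₁]
    by_cases hxv : x = v
    · subst hxv
      rw [Function.update_self]
      exact hy₂'
    · rw [Function.update_of_ne hxv]
      rcases h₂ x ((hx.resolve_left hx₁).resolve_left hxv).1 hx' with rfl | rfl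
      · exact (hxv rfl).elim
      · exact C.symm _ _ _ _ hy₂)
  refine ⟨_, fun a ha b hb => e₂ a ?_ b ?_⟩ <;> simp only [Set.mem_insert_iff, Set.mem_sdiff,
    Set.mem_singleton_iff] <;> tauto

/-- Induction on `s`: remove the configuration found in the induced subgraph, solve the rest,
extend. -/
theorem solvableOn_of_forall_reducibleConfig [Finite V] (C : ConstraintSystem G S)
    (hS : Nat.card S = 6)
    (hG : ∀ s : Set V, s.Nonempty → ReducibleConfig (G.induce s)) (s : Set V) :
    C.SolvableOn s := by
  induction s using WellFoundedLT.induction with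
  | _ s ih =>
  have hlt : ∀ (v : V) (t : Set V), v ∈ s → v ∈ t → s \ t < s := fun v t hv ht =>
    Set.ssubset_iff_subset_ne.2 ⟨Set.sdiff_subset, fun he => by
      rw [← he] at hv
      exact hv.2 ht⟩
  rcases s.eq_empty_or_nonempty with rfl | hs
  · have : Nonempty S := (Nat.card_pos_iff.1 (by omega : 0 < Nat.card S)).1
    exact ⟨fun _ => Classical.arbitrary S, by simp⟩
  · cases hG s hs with
    | leaf v h =>
      exact (ih (s \ {v.1}) (hlt v _ v.2 rfl)).leaf hS v.2 fun x hx y hy hvx hvy =>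
        congrArg Subtype.val (h ⟨x, hx⟩ ⟨y, hy⟩ hvx hvy)
    | pair v₁ v₂ u w h hu hw h₁ h₂ =>
      refine (ih (s \ {v₁.1, v₂.1}) (hlt v₁ _ v₁.2 (by simp))).pair hS h hu hw
        (fun x hx hx' => ?_) (fun x hx hx' => ?_)
      · simpa [Subtype.ext_iff] using h₁ ⟨x, hx⟩ hx'
      · simpa [Subtype.ext_iff] using h₂ ⟨x, hx⟩ hx'
    | star v v₁ v₂ u w₁ w₂ hv₁ hv₂ hu hw₁ hw₂ hn h h₁ h₂ =>
      refine (ih (s \ {v.1, v₁.1, v₂.1}) (hlt v _ v.2 (by simp))).star hS hv₁ hv₂ hu hw₁ hw₂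
        hn (fun x hx hx' => ?_) (fun x hx hx' => ?_) (fun x hx hx' => ?_)
      · simpa [Subtype.ext_iff] using h ⟨x, hx⟩ hx'
      · simpa [Subtype.ext_iff] using h₁ ⟨x, hx⟩ hx'
      · simpa [Subtype.ext_iff] using h₂ ⟨x, hx⟩ hx'

end ConstraintSystem

/-! ### Discharging. -/

/-- Discharging: a finite graph with average degree below `8 / 3` has a reducible configuration. -/
theorem reducibleConfig_of_card_edges_lt {V : Type*} [Fintype V] (G : SimpleGraph V)
    [DecidableRel G.Adj] (h : 3 * G.edgeFinset.card < 4 * Fintype.card V) :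
    ReducibleConfig G := by
  classical
  by_contra hG
  have hmem : ∀ v w, w ∈ G.neighborFinset v ↔ G.Adj v w := fun v w => G.mem_neighborFinset v w
  have hdeg : ∀ v, 2 ≤ G.degree v := by
    intro v
    by_contra! hv
    refine hG (.leaf v fun x y hx hy => ?_)
    exact Finset.card_le_one.1 (Nat.lt_succ_iff.1 hv) x ((hmem _ _).2 hx) y ((hmem _ _).2 hy)
  have htwo : ∀ v x, G.degree v = 2 → G.Adj v x →
      ∃ u, G.Adj v u ∧ u ≠ x ∧ ∀ y, G.Adj v y → y = x ∨ y = u := by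
    intro v x hv hx
    have hc : ((G.neighborFinset v).erase x).card = 1 := by
      rw [Finset.card_erase_of_mem ((hmem _ _).2 hx), G.card_neighborFinset_eq_degree, hv]
    obtain ⟨u, hu⟩ := Finset.card_eq_one.1 hc
    have hu' : ∀ y, y ≠ x ∧ G.Adj v y ↔ y = u := fun y => by
      rw [← hmem, ← Finset.mem_erase, hu, Finset.mem_singleton]
    exact ⟨u, ((hu' u).2 rfl).2, ((hu' u).2 rfl).1, fun y hy => by
      by_cases hyx : y = x
      · exact .inl hyx
      · exact .inr ((hu' y).1 ⟨hyx, hy⟩)⟩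
  have hpair : ∀ v w, G.Adj v w → G.degree v = 2 → G.degree w ≠ 2 := by
    intro v w hvw hv hw
    obtain ⟨u, hu, -, hu'⟩ := htwo v w hv hvw
    obtain ⟨x, hx, -, hx'⟩ := htwo w v hw hvw.symm
    exact hG (.pair v w u x hvw hu hx (fun y hy => (hu' y hy).symm)
      (fun y hy => (hx' y hy).symm))
  set t : V → ℕ := fun v => ((G.neighborFinset v).filter fun w => G.degree w = 2).card with ht
  have hstar : ∀ v, G.degree v = 3 → t v ≤ 1 := by
    intro v hv
    by_contra! hlt
    obtain ⟨v₁, hv₁, v₂, hv₂, hne⟩ := Finset.one_lt_card.1 hlt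
    rw [Finset.mem_filter, hmem] at hv₁ hv₂
    obtain ⟨w₁, hw₁, -, hw₁'⟩ := htwo v₁ v hv₁.2 hv₁.1.symm
    obtain ⟨w₂, hw₂, -, hw₂'⟩ := htwo v₂ v hv₂.2 hv₂.1.symm
    have hc : (((G.neighborFinset v).erase v₁).erase v₂).card = 1 := by
      rw [Finset.card_erase_of_mem (Finset.mem_erase.2 ⟨hne.symm, (hmem _ _).2 hv₂.1⟩),
        Finset.card_erase_of_mem ((hmem _ _).2 hv₁.1), G.card_neighborFinset_eq_degree, hv]
    obtain ⟨u, hu⟩ := Finset.card_eq_one.1 hc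
    have hu' : ∀ y, y ≠ v₂ ∧ y ≠ v₁ ∧ G.Adj v y ↔ y = u := fun y => by
      rw [← hmem, ← Finset.mem_erase, ← Finset.mem_erase, hu, Finset.mem_singleton]
    refine hG (.star v v₁ v₂ u w₁ w₂ hv₁.1 hv₂.1 ((hu' u).2 rfl).2.2 hw₁ hw₂
      (fun ha => hpair _ _ ha hv₁.2 hv₂.2) (fun y hy => ?_) hw₁' hw₂')
    have := hu' y
    tauto
  -- Double counting: a vertex of degree 2 is counted once by each of its two neighbours.
  have hsum : ∑ v, t v = 2 * (Finset.univ.filter fun w => G.degree w = 2).card := by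
    have h₁ : ∀ v, t v = ∑ w, if G.Adj v w ∧ G.degree w = 2 then 1 else 0 := fun v => by
      rw [Finset.sum_boole, ht]
      simp only [Nat.cast_id]
      congr 1
      ext w
      simp
    simp_rw [h₁]
    rw [Finset.sum_comm, mul_comm, ← smul_eq_mul, ← Finset.sum_const, Finset.sum_filter]
    refine Finset.sum_congr rfl fun w _ => ?_
    split_ifs with hw
    · simp only [hw, and_true]
      rw [Finset.sum_boole, Nat.cast_id, ← hw, ← G.card_neighborFinset_eq_degree]
      congr 1
      ext v
      simp [G.adj_comm]
    · simp [hw]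
  -- The initial charge is `3 * degree - 8`, and every vertex of degree 2 receives 1 from each
  -- neighbour. Final charges are nonnegative: degree 2 gives nothing away, degree 3 gives at most
  -- 1, and for `d ≥ 4` one has `3 * d - d ≥ 8`. Summing gives `8 * |V| ≤ 6 * |E|`.
  have hv : ∀ v, 8 + t v ≤ 3 * G.degree v + if G.degree v = 2 then 2 else 0 := by
    intro v
    have h₂ := hdeg v
    have hle : t v ≤ G.degree v := Finset.card_filter_le _ _
    have h₃ := hstar v
    split_ifs with hv
    · have : t v = 0 := by
        rw [ht, Finset.card_eq_zero, Finset.filter_eq_empty_iff]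
        exact fun w hw => hpair v w ((hmem _ _).1 hw) hv
      omega
    · omega
  have := Finset.sum_le_sum fun v (_ : v ∈ Finset.univ) => hv v
  rw [Finset.sum_add_distrib, Finset.sum_add_distrib, ← Finset.mul_sum, hsum,
    G.sum_degrees_eq_twice_card_edges, ← Finset.sum_filter, Finset.sum_const, Finset.sum_const,
    smul_eq_mul, smul_eq_mul, Finset.card_univ] at this
  omega

/-! ### Pairs of disjoint colorings as a constraint system. -/

/-- Ordered pairs of distinct elements of `Fin 3`: the choices of two disjoint colors. -/
abbrev ColorPair : Type := {p : Fin 3 × Fin 3 // p.1 ≠ p.2}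

/-- A matching is a partial injection, which extends to a permutation of a finite set. The added
edges only strengthen the constraints, so bounds on excluded states may be computed for
permutations. -/
theorem exists_perm_of_matching (M : Fin 3 → Fin 3 → Prop)
    (h₁ : ∀ i j j', M i j → M i j' → j = j') (h₂ : ∀ i i' j, M i j → M i' j → i = i') :
    ∃ σ : Equiv.Perm (Fin 3), ∀ i j, M i j → σ i = j := by
  classical
  let f : {i // ∃ j, M i j} → Fin 3 := fun i => i.2.choose
  have hf : ∀ i, M i.1 (f i) := fun i => i.2.choose_spec
  have hinj : Function.Injective f := fun a b hab =>
    Subtype.ext (h₂ _ _ _ (hf a) (hab ▸ hf b))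
  obtain ⟨σ, hσ⟩ := Equiv.Perm.exists_extending_pair (Subtype.val : {i // ∃ j, M i j} → Fin 3) f
    Subtype.val_injective hinj
  exact ⟨σ, fun i j hij => (hσ ⟨i, j, hij⟩).trans (h₁ i _ _ (hf ⟨i, j, hij⟩) hij)⟩

theorem ColorPair.card_excluded (a : ColorPair) :
    (Finset.univ.filter fun y : ColorPair => ¬ (a.1.1 ≠ y.1.1 ∧ a.1.2 ≠ y.1.2)).card ≤ 3 := by
  revert a
  decide

/-- If `b` is the swap of `a`, both coordinates of `y` are forced to be the third color; this is the
only obstruction. -/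
theorem ColorPair.exists_between (a b : ColorPair) (h : b.1 ≠ a.1.swap) :
    ∃ y : ColorPair, (a.1.1 ≠ y.1.1 ∧ a.1.2 ≠ y.1.2) ∧ y.1.1 ≠ b.1.1 ∧ y.1.2 ≠ b.1.2 := by
  revert a b
  decide

theorem ColorPair.natCard : Nat.card ColorPair = 6 := by
  rw [Nat.card_eq_fintype_card]
  decide

/-- The action of a permutation of the colors on pairs. -/
def ColorPair.map (σ : Equiv.Perm (Fin 3)) (a : ColorPair) : ColorPair :=
  ⟨(σ a.1.1, σ a.1.2), fun h => a.2 (σ.injective h)⟩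

theorem CorrespondenceCover.exists_perm {V W : Type*} {G : SimpleGraph V}
    (C : CorrespondenceCover G W) (e : ∀ v, Fin 3 ≃ C.L v) {u v : V} (h : G.Adj u v) :
    ∃ σ : Equiv.Perm (Fin 3), ∀ i j, C.H.Adj (e u i) (e v j) → σ i = j := by
  refine exists_perm_of_matching _ (fun i j j' hj hj' => ?_) (fun i i' j hi hi' => ?_)
  · exact (e v).injective (Subtype.ext
      (C.matching u v h _ (e u i).2 _ (e v j).2 _ (e v j').2 hj hj'))
  · exact (e u).injective (Subtype.ext
      (C.matching v u h.symm _ (e v j).2 _ (e u i).2 _ (e u i').2 hi.symm hi'.symm))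

/-- The constraint system whose solutions are the pairs of disjoint colorings of a cover. -/
def CorrespondenceCover.constraintSystem {V W : Type*} {G : SimpleGraph V}
    (C : CorrespondenceCover G W) (e : ∀ v, Fin 3 ≃ C.L v) : ConstraintSystem G ColorPair where
  rel u v x y := ¬ C.H.Adj (e u x.1.1) (e v y.1.1) ∧ ¬ C.H.Adj (e u x.1.2) (e v y.1.2)
  symm u v x y h := ⟨fun h' => h.1 h'.symm, fun h' => h.2 h'.symm⟩
  ncard_excluded u v h x := by
    obtain ⟨σ, hσ⟩ := C.exists_perm e h
    refine le_trans (Set.ncard_le_ncard (t := ↑(Finset.univ.filter fun y : ColorPair =>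
      ¬ ((x.map σ).1.1 ≠ y.1.1 ∧ (x.map σ).1.2 ≠ y.1.2))) (fun y hy => ?_) (Set.toFinite _)) ?_
    · simp only [Finset.coe_filter, Finset.mem_univ, true_and, Set.mem_ofPred_eq] at hy ⊢
      exact fun h' => hy ⟨fun h₁ => h'.1 (hσ _ _ h₁), fun h₂ => h'.2 (hσ _ _ h₂)⟩
    · rw [Set.ncard_coe_finset]
      exact ColorPair.card_excluded _
  ncard_unreachable u v w h h' x := by
    obtain ⟨σ, hσ⟩ := C.exists_perm e h
    obtain ⟨τ, hτ⟩ := C.exists_perm e h'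
    rw [Set.ncard_le_one (Set.toFinite _)]
    -- After transport by the two permutations, the only state that can be unreachable is the swap
    -- of `x`.
    suffices H : ∀ z : ColorPair, (¬ ∃ y : ColorPair,
        (¬ C.H.Adj (e u x.1.1) (e v y.1.1) ∧ ¬ C.H.Adj (e u x.1.2) (e v y.1.2)) ∧
        (¬ C.H.Adj (e v y.1.1) (e w z.1.1) ∧ ¬ C.H.Adj (e v y.1.2) (e w z.1.2))) →
        z.1 = (τ (σ x.1.2), τ (σ x.1.1)) by
      exact fun a ha b hb => Subtype.ext ((H a ha).trans (H b hb).symm)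
    intro z hz
    by_contra hne
    obtain ⟨y, ⟨h₁, h₂⟩, h₃, h₄⟩ := ColorPair.exists_between (x.map σ) (z.map τ⁻¹) (by
      intro hs
      apply hne
      have h₁ := congrArg Prod.fst hs
      have h₂ := congrArg Prod.snd hs
      simp only [ColorPair.map, Prod.fst_swap, Prod.snd_swap] at h₁ h₂
      rw [Equiv.Perm.inv_eq_iff_eq] at h₁ h₂
      exact Prod.ext h₁ h₂)
    exact hz ⟨y, ⟨fun h => h₁ (hσ _ _ h), fun h => h₂ (hσ _ _ h)⟩,
      fun h => h₃ (Equiv.Perm.eq_inv_iff_eq.2 (hτ _ _ h)),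
      fun h => h₄ (Equiv.Perm.eq_inv_iff_eq.2 (hτ _ _ h))⟩

theorem CorrespondenceCover.isColoring_range {V W : Type*} {G : SimpleGraph V}
    (C : CorrespondenceCover G W) (f : ∀ v, C.L v)
    (hf : ∀ u v, G.Adj u v → ¬ C.H.Adj (f u) (f v)) :
    C.IsColoring (Set.range fun v => (f v : W)) := by
  refine ⟨?_, fun v => ⟨f v, ⟨⟨v, rfl⟩, (f v).2⟩, ?_⟩⟩
  · rintro _ ⟨u, rfl⟩ _ ⟨v, rfl⟩ hne h
    by_cases huv : G.Adj u v
    · exact hf u v huv h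
    · exact C.not_adj u v (fun h => hne (by rw [h])) huv _ (f u).2 _ (f v).2 h
  · rintro _ ⟨⟨u, rfl⟩, hu⟩
    rw [(C.existsUnique_mem (f u)).unique (f u).2 hu]

/-- A `3`-fold cover of a graph all of whose induced subgraphs have a reducible configuration has
two disjoint colorings. -/
theorem CorrespondenceCover.exists_disjoint_colorings {V W : Type*} [Finite V]
    {G : SimpleGraph V} (C : CorrespondenceCover G W) (hC : C.IsFold 3)
    (hG : ∀ s : Set V, s.Nonempty → ReducibleConfig (G.induce s)) :
    ∃ I J : Set W, C.IsColoring I ∧ C.IsColoring J ∧ Disjoint I J := by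
  have e : ∀ v, Nonempty (Fin 3 ≃ C.L v) := fun v => by
    have hc : Nat.card (C.L v) = 3 := by
      rw [Nat.card_coe_set_eq, Set.ncard_def, hC v]
      rfl
    have : Finite (C.L v) := Nat.finite_of_card_ne_zero (by omega)
    exact ⟨(Finite.equivFinOfCardEq hc).symm⟩
  replace e := fun v => (e v).some
  obtain ⟨f, hf⟩ := (C.constraintSystem e).solvableOn_of_forall_reducibleConfig
    ColorPair.natCard hG Set.univ
  refine ⟨_, _, C.isColoring_range (fun v => e v (f v).1.1) fun u v h => ?_,
    C.isColoring_range (fun v => e v (f v).1.2) fun u v h => ?_, ?_⟩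
  · exact (hf u trivial v trivial h).1
  · exact (hf u trivial v trivial h).2
  · rw [Set.disjoint_left]
    rintro _ ⟨u, rfl⟩ ⟨v, hv⟩
    have huv : v = u := (C.existsUnique_mem (e u (f u).1.1)).unique
      ((show (e v (f v).1.2 : W) = e u (f u).1.1 from hv) ▸ (e v (f v).1.2).2) (e u (f u).1.1).2
    subst huv
    exact (f v).2 ((e v).injective (Subtype.ext hv)).symm

/-! ### Cycle space over 𝔽₂, girth and sparsity. -/

/-- The boundary over `𝔽₂` of an edge chain of a multigraph whose edges have the ends `a e` and
`b e`. -/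
def edgeBoundary {V E : Type*} [Fintype E] [DecidableEq V] (a b : E → V) :
    (E → ZMod 2) →ₗ[ZMod 2] (V → ZMod 2) where
  toFun z v := ∑ e, ((if a e = v then z e else 0) + if b e = v then z e else 0)
  map_add' z z' := by
    ext v
    simp only [Pi.add_apply, ← Finset.sum_add_distrib]
    refine Finset.sum_congr rfl fun e _ => ?_
    split_ifs <;> ring
  map_smul' c z := by
    ext v
    simp [Finset.mul_sum, mul_add]

section

variable {V E : Type*} [DecidableEq V] [Fintype E] (a b : E → V)

theorem edgeBoundary_apply (z : E → ZMod 2) (v : V) : edgeBoundary a b z v =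
    ∑ e, ((if a e = v then z e else 0) + if b e = v then z e else 0) := rfl

theorem sum_edgeBoundary (z : E → ZMod 2) (S : Finset V) : ∑ v ∈ S, edgeBoundary a b z v =
    ∑ e, ((if a e ∈ S then z e else 0) + if b e ∈ S then z e else 0) := by
  simp_rw [edgeBoundary_apply]
  rw [Finset.sum_comm]
  refine Finset.sum_congr rfl fun e _ => ?_
  rw [Finset.sum_add_distrib, Finset.sum_ite_eq, Finset.sum_ite_eq]

/-- A boundary has coordinate sum zero, because every edge has two ends. So a unit vector is not a
boundary, the rank is at most |V| - 1, and rank-nullity applies. -/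
theorem card_lt_finrank_ker_edgeBoundary [Fintype V] [Nonempty V] : Fintype.card E <
    Module.finrank (ZMod 2) (LinearMap.ker (edgeBoundary a b)) + Fintype.card V := by
  have h₁ := (edgeBoundary a b).finrank_range_add_finrank_ker
  have h₂ : Module.finrank (ZMod 2) (LinearMap.range (edgeBoundary a b)) < Fintype.card V := by
    rw [← Module.finrank_fintype_fun_eq_card (ZMod 2) (η := V)]
    refine Submodule.finrank_lt fun h => ?_
    obtain ⟨z, hz⟩ := LinearMap.range_eq_top.1 h (Pi.single (Classical.arbitrary V) 1)
    have := sum_edgeBoundary a b z Finset.univ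
    rw [hz] at this
    simp [CharTwo.add_self_eq_zero] at this
  rw [Module.finrank_fintype_fun_eq_card] at h₁
  omega

open Classical in
/-- The support of a non-zero element of the cycle space contains a cycle. -/
theorem egirth_le_card_support [Fintype V] (G : SimpleGraph V) (hab : ∀ e, G.Adj (a e) (b e))
    (hinj : Function.Injective fun e => s(a e, b e)) {z : E → ZMod 2}
    (hz : edgeBoundary a b z = 0) (hne : z ≠ 0) :
    G.egirth ≤ (Finset.univ.filter fun e => z e ≠ 0).card := by
  set T := Finset.univ.filter fun e => z e ≠ 0 with hT
  let H : SimpleGraph V := .fromEdgeSet (T.image fun e => s(a e, b e))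
  have hH : ∀ e, z e ≠ 0 → H.Adj (a e) (b e) := fun e he => by
    rw [SimpleGraph.fromEdgeSet_adj]
    exact ⟨Finset.mem_coe.2 (Finset.mem_image_of_mem _ (by simpa [hT] using he)), (hab e).ne⟩
  have hHG : H ≤ G := by
    intro u v huv
    obtain ⟨e, -, he⟩ := Finset.mem_image.1 (Finset.mem_coe.1
      ((SimpleGraph.fromEdgeSet_adj _).1 huv).1)
    rw [← SimpleGraph.mem_edgeSet, ← he]
    exact hab e
  by_cases hac : H.IsAcyclic
  · exfalso
    obtain ⟨e₀, he₀⟩ := Function.ne_iff.1 hne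
    have hbr := SimpleGraph.isAcyclic_iff_forall_adj_isBridge.1 hac (hH e₀ he₀)
    rw [SimpleGraph.isBridge_iff] at hbr
    set D := H.deleteEdges {s(a e₀, b e₀)} with hD
    -- If the support is a forest, `e₀` is a bridge of it. Summing the boundary over one side of the
    -- bridge leaves only `z e₀`, as every other support edge has both ends or no end on that side.
    have hsum := sum_edgeBoundary a b z (Finset.univ.filter fun x => D.Reachable (a e₀) x)
    rw [hz, Finset.sum_eq_single e₀] at hsum
    · simp only [Finset.mem_filter, Finset.mem_univ, true_and, SimpleGraph.Reachable.refl,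
        if_true] at hsum
      rw [if_neg hbr] at hsum
      simp at hsum
      exact he₀ hsum.symm
    · intro e _ hee
      by_cases he : z e = 0
      · simp [he]
      · have hadj : D.Adj (a e) (b e) := by
          rw [hD, SimpleGraph.deleteEdges_adj]
          exact ⟨hH e he, fun h => hee (hinj h)⟩
        have : D.Reachable (a e₀) (a e) ↔ D.Reachable (a e₀) (b e) :=
          ⟨fun h => h.trans hadj.reachable, fun h => h.trans hadj.symm.reachable⟩
        simp only [Finset.mem_filter, Finset.mem_univ, true_and, this, CharTwo.add_self_eq_zero]
    · simp
  · rw [SimpleGraph.IsAcyclic] at hac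
    push Not at hac
    obtain ⟨v, c, hc⟩ := hac
    refine (SimpleGraph.egirth_le_length (hc.mapLe hHG)).trans ?_
    rw [SimpleGraph.Walk.length_map, ← SimpleGraph.Walk.length_edges,
      ← List.toFinset_card_of_nodup hc.isTrail.edges_nodup]
    refine Nat.cast_le.2 ((Finset.card_le_card fun x hx => ?_).trans
      (Finset.card_image_le (s := T) (f := fun e => s(a e, b e))))
    have := c.edges_subset_edgeSet (List.mem_toFinset.1 hx)
    rw [SimpleGraph.edgeSet_fromEdgeSet] at this
    exact Finset.mem_coe.1 this.1

/-- If the cycle space of a graph of girth at least `8` is the cut space of a multigraph, then the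
graph is sparse. -/
theorem three_mul_card_add_four_le_of_dual [Fintype V] [Nonempty V] (G : SimpleGraph V)
    (hG : 8 ≤ G.egirth) (hab : ∀ e, G.Adj (a e) (b e))
    (hinj : Function.Injective fun e => s(a e, b e)) {Y : Type*} (s t : E → Y)
    (hdual : ∀ z : E → ZMod 2, edgeBoundary a b z = 0 ↔
      ∃ g : Y → ZMod 2, ∀ e, z e = g (s e) + g (t e)) :
    3 * Fintype.card E + 4 ≤ 4 * Fintype.card V := by
  classical
  let star : Y → E → ZMod 2 := fun y e => (if s e = y then 1 else 0) + if t e = y then 1 else 0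
  have hstar : ∀ y, star y ∈ LinearMap.ker (edgeBoundary a b) := fun y =>
    (hdual _).2 ⟨fun x => if x = y then 1 else 0, fun e => rfl⟩
  obtain ⟨B, hB, hspan, hind⟩ := exists_linearIndependent (ZMod 2) (Set.range star)
  have hker : LinearMap.ker (edgeBoundary a b) ≤ Submodule.span (ZMod 2) B := by
    intro z hz
    obtain ⟨g, hg⟩ := (hdual z).1 hz
    -- `Y` may be infinite, but only the stars of ends of edges matter.
    let Y₀ : Finset Y := Finset.univ.image s ∪ Finset.univ.image t
    have : z = ∑ y ∈ Y₀, g y • star y := by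
      ext e
      have h₁ : s e ∈ Y₀ := Finset.mem_union_left _ (Finset.mem_image_of_mem _ (Finset.mem_univ _))
      have h₂ : t e ∈ Y₀ := Finset.mem_union_right _ (Finset.mem_image_of_mem _ (Finset.mem_univ _))
      simp [hg e, star, mul_add, Finset.sum_add_distrib, h₁, h₂]
    rw [hspan, this]
    exact Submodule.sum_mem _ fun y _ => Submodule.smul_mem _ _ (Submodule.subset_span ⟨y, rfl⟩)
  have : Fintype B := Fintype.ofFinite B
  have hcard : Fintype.card E < Fintype.card B + Fintype.card V :=
    (card_lt_finrank_ker_edgeBoundary a b).trans_le (Nat.add_le_add_right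
      ((Submodule.finrank_mono hker).trans (finrank_span_set_eq_card hind).le |>.trans
        (by rw [Set.toFinset_card])) _)
  choose y hy using fun x : B => hB x.2
  have hyinj : Function.Injective y := fun x x' h => Subtype.ext (by rw [← hy x, ← hy x', h])
  have hsupp : ∀ x : B, 8 ≤ (Finset.univ.filter fun e => x.1 e ≠ 0).card := fun x => by
    have := hG.trans (egirth_le_card_support a b G hab hinj (z := x.1)
      (by rw [← hy x]; exact hstar _) (hind.ne_zero x))
    exact_mod_cast this
  -- Distinct elements of `B` are stars of distinct vertices, and only the stars of `s e` and `t e`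
  -- can contain `e`.
  have htwo : ∀ e, (Finset.univ.filter fun x : B => x.1 e ≠ 0).card ≤ 2 := fun e => by
    refine (Finset.card_le_card_of_injOn y (t := {s e, t e}) (fun x hx => ?_)
      hyinj.injOn).trans Finset.card_le_two
    by_contra hxe
    simp only [Finset.coe_insert, Finset.coe_singleton, Set.mem_insert_iff,
      Set.mem_singleton_iff, not_or] at hxe
    refine (Finset.mem_filter.1 hx).2 ?_
    rw [← hy x]
    simp [star, Ne.symm hxe.1, Ne.symm hxe.2]
  -- Double counting of incidences gives `8 * |B| ≤ 2 * |E|`, to be combined with `|E| < |B| + |V|`.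
  have h₁ := Finset.sum_le_sum fun x (_ : x ∈ (Finset.univ : Finset B)) => hsupp x
  have h₂ := Finset.sum_le_sum fun e (_ : e ∈ (Finset.univ : Finset E)) => htwo e
  have h₃ := (h₁.trans_eq (Finset.sum_card_bipartiteAbove_eq_sum_card_bipartiteBelow
    (fun (x : B) e => x.1 e ≠ 0))).trans h₂
  simp only [Finset.sum_const, Finset.card_univ, smul_eq_mul] at h₃
  omega

end

/-! ### Chains over 𝔽₂ in the square grid. -/

/-- The four neighbours of a point of the square grid. -/
def gridNeighbors (x : ℤ × ℤ) : Finset (ℤ × ℤ) :=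
  {(x.1 + 1, x.2), (x.1 - 1, x.2), (x.1, x.2 + 1), (x.1, x.2 - 1)}

theorem mem_gridNeighbors {x y : ℤ × ℤ} : y ∈ gridNeighbors x ↔
    (y.1 = x.1 + 1 ∧ y.2 = x.2) ∨ (y.1 = x.1 - 1 ∧ y.2 = x.2) ∨
    (y.1 = x.1 ∧ y.2 = x.2 + 1) ∨ (y.1 = x.1 ∧ y.2 = x.2 - 1) := by
  simp [gridNeighbors, Prod.ext_iff]

/-- The square grid. -/
def squareGrid : SimpleGraph (ℤ × ℤ) where
  Adj x y := y ∈ gridNeighbors x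
  symm := ⟨fun x y h => by
    rw [mem_gridNeighbors] at h ⊢
    omega⟩
  loopless := ⟨fun x h => by
    rw [mem_gridNeighbors] at h
    omega⟩

theorem squareGrid_adj {x y : ℤ × ℤ} : squareGrid.Adj x y ↔ y ∈ gridNeighbors x := Iff.rfl

theorem sum_gridNeighbors {M : Type*} [AddCommMonoid M] (x : ℤ × ℤ) (φ : ℤ × ℤ → M) :
    ∑ y ∈ gridNeighbors x, φ y =
      φ (x.1 + 1, x.2) + (φ (x.1 - 1, x.2) + (φ (x.1, x.2 + 1) + φ (x.1, x.2 - 1))) := by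
  rw [gridNeighbors, Finset.sum_insert, Finset.sum_insert, Finset.sum_insert,
    Finset.sum_singleton] <;> simp [Prod.ext_iff] <;> omega

/-- One of the two cells on the sides of an edge `xy` of the square grid, where a cell is named
by its lower left corner. -/
def leftCell (x y : ℤ × ℤ) : ℤ × ℤ := (min x.1 y.1, min x.2 y.2)

/-- The other one of the two cells on the sides of an edge `xy` of the square grid. -/
def rightCell (x y : ℤ × ℤ) : ℤ × ℤ := (min x.1 y.1 - |x.2 - y.2|, min x.2 y.2 - |x.1 - y.1|)

/-- The coboundary over `𝔽₂` of a function on the cells of the square grid. -/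
def cellDiff (f : ℤ × ℤ → ZMod 2) (x y : ℤ × ℤ) : ZMod 2 :=
  f (leftCell x y) + f (rightCell x y)

theorem cellDiff_comm (f : ℤ × ℤ → ZMod 2) (x y : ℤ × ℤ) : cellDiff f x y = cellDiff f y x := by
  simp only [cellDiff, leftCell, rightCell, min_comm, abs_sub_comm]

theorem cellDiff_horizontal (f : ℤ × ℤ → ZMod 2) (i j : ℤ) :
    cellDiff f (i, j) (i + 1, j) = f (i, j) + f (i, j - 1) := by
  simp [cellDiff, leftCell, rightCell]

theorem cellDiff_vertical (f : ℤ × ℤ → ZMod 2) (i j : ℤ) :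
    cellDiff f (i, j) (i, j + 1) = f (i, j) + f (i - 1, j) := by
  simp [cellDiff, leftCell, rightCell]

/-- Each of the four cells around a grid point lies beside two of the four edges there, so it is
counted twice. -/
theorem sum_cellDiff (f : ℤ × ℤ → ZMod 2) (x : ℤ × ℤ) :
    ∑ y ∈ gridNeighbors x, cellDiff f x y = 0 := by
  obtain ⟨i, j⟩ := x
  have h₁ := cellDiff_horizontal f (i - 1) j
  have h₂ := cellDiff_vertical f i (j - 1)
  rw [sub_add_cancel, cellDiff_comm] at h₁ h₂
  rw [sum_gridNeighbors]
  dsimp only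
  rw [cellDiff_horizontal, cellDiff_vertical, h₁, h₂]
  generalize f (i, j) = a, f (i, j - 1) = b, f (i - 1, j) = c, f (i - 1, j - 1) = d
  revert a b c d
  decide

/-- The boundary over `𝔽₂` of an edge chain of the square grid. -/
def gridBoundary (c : Sym2 (ℤ × ℤ) → ZMod 2) (x : ℤ × ℤ) : ZMod 2 :=
  ∑ y ∈ gridNeighbors x, c s(x, y)

/-- Partial sums from 0 in both directions; at least one of the two intervals is always empty, and
in characteristic two the sign on the negative side does not matter. -/
theorem exists_int_primitive (k : ZMod 2) (a : ℤ → ZMod 2) :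
    ∃ F : ℤ → ZMod 2, F 0 = k ∧ ∀ j, F (j + 1) = F j + a (j + 1) := by
  refine ⟨fun j => k + (∑ i ∈ Finset.Ioc 0 j, a i + ∑ i ∈ Finset.Ioc j 0, a i), by simp,
    fun j => ?_⟩
  dsimp only
  rcases le_or_gt 0 j with hj | hj
  · have h : Finset.Ioc 0 (j + 1) = insert (j + 1) (Finset.Ioc 0 j) := by
      ext i
      simp only [Finset.mem_Ioc, Finset.mem_insert]
      omega
    rw [h, Finset.sum_insert (by simp), Finset.Ioc_eq_empty (a := j + 1) (by omega),
      Finset.Ioc_eq_empty (a := j) (by omega)]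
    simp only [Finset.sum_empty]
    ring
  · have h : Finset.Ioc j 0 = insert (j + 1) (Finset.Ioc (j + 1) 0) := by
      ext i
      simp only [Finset.mem_Ioc, Finset.mem_insert]
      omega
    rw [h, Finset.sum_insert (by simp), Finset.Ioc_eq_empty (b := j) (by omega),
      Finset.Ioc_eq_empty (b := j + 1) (by omega)]
    have := CharTwo.add_self_eq_zero (a (j + 1))
    simp only [Finset.sum_empty]
    linear_combination -this

/-- Every edge chain of the square grid without boundary is a coboundary of cells. -/
theorem exists_cellDiff_of_gridBoundary (c : Sym2 (ℤ × ℤ) → ZMod 2)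
    (hc : ∀ x, gridBoundary c x = 0) :
    ∃ f, ∀ x y, squareGrid.Adj x y → c s(x, y) = cellDiff f x y := by
  -- The potential is integrated along row 0 of cells, across vertical edges, and then along each
  -- column, across horizontal edges. Only the vertical edges off row 0 remain to be checked;
  -- vanishing boundary at a grid point carries the identity between consecutive rows.
  obtain ⟨G, -, hG⟩ := exists_int_primitive 0 fun i => c s((i, 0), (i, 1))
  choose H hH₀ hH using fun i => exists_int_primitive (G i) fun j => c s((i, j), (i + 1, j))
  have hb : ∀ i j, c s((i, j), (i + 1, j)) + (c s((i - 1, j), (i, j)) +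
      (c s((i, j), (i, j + 1)) + c s((i, j - 1), (i, j)))) = 0 := fun i j => by
    rw [← hc (i, j), gridBoundary, sum_gridNeighbors, Sym2.eq_swap (a := (i - 1, j)),
      Sym2.eq_swap (a := (i, j - 1))]
  have hv : ∀ i j, c s((i, j), (i, j + 1)) = H i j + H (i - 1) j := by
    intro i j
    have hstep : ∀ j, (c s((i, j), (i, j + 1)) = H i j + H (i - 1) j ↔
        c s((i, j + 1), (i, j + 1 + 1)) = H i (j + 1) + H (i - 1) (j + 1)) := by
      intro j
      have h₁ := hb i (j + 1)
      have h₂ := hH i j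
      have h₃ := hH (i - 1) j
      rw [add_sub_cancel_right] at h₁
      rw [sub_add_cancel] at h₃
      rw [h₂, h₃]
      generalize c s((i, j), (i, j + 1)) = a, c s((i, j + 1), (i, j + 1 + 1)) = b,
        c s((i, j + 1), (i + 1, j + 1)) = d, c s((i - 1, j + 1), (i, j + 1)) = e,
        H i j = g, H (i - 1) j = h at h₁ ⊢
      revert a b d e g h
      decide
    induction j using Int.induction_on with
    | zero =>
      have := hG (i - 1)
      rw [sub_add_cancel] at this
      rw [hH₀, hH₀, this]
      have := CharTwo.add_self_eq_zero (G (i - 1))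
      simp only [zero_add]
      linear_combination -this
    | succ j ih => exact (hstep j).1 ih
    | pred j ih => exact (hstep (-j - 1)).2 (by rwa [sub_add_cancel])
  have hh : ∀ i j, c s((i, j), (i + 1, j)) = H i j + H i (j - 1) := by
    intro i j
    have h₁ := hH i (j - 1)
    rw [sub_add_cancel] at h₁
    have h₂ := CharTwo.add_self_eq_zero (H i (j - 1))
    linear_combination -h₁ - h₂
  refine ⟨fun p => H p.1 p.2, ?_⟩
  rintro ⟨i, j⟩ ⟨k, l⟩ h
  rw [squareGrid_adj, mem_gridNeighbors] at h
  dsimp only at h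
  rcases h with ⟨rfl, rfl⟩ | ⟨rfl, rfl⟩ | ⟨rfl, rfl⟩ | ⟨rfl, rfl⟩
  · rw [cellDiff_horizontal, hh]
  · have h₁ := hh (i - 1) l
    have h₂ := cellDiff_horizontal (fun p => H p.1 p.2) (i - 1) l
    rw [sub_add_cancel] at h₁ h₂
    rw [cellDiff_comm, h₂, Sym2.eq_swap, h₁]
  · rw [cellDiff_vertical, hv]
  · have h₁ := hv k (j - 1)
    have h₂ := cellDiff_vertical (fun p => H p.1 p.2) k (j - 1)
    rw [sub_add_cancel] at h₁ h₂
    rw [cellDiff_comm, h₂, Sym2.eq_swap, h₁]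

theorem gridBoundary_edge {u v : ℤ × ℤ} (h : squareGrid.Adj u v) (x : ℤ × ℤ) :
    gridBoundary (fun e => if s(u, v) = e then 1 else 0) x =
      (if u = x then 1 else 0) + if v = x then 1 else 0 := by
  have hne := h.ne
  rw [gridBoundary]
  by_cases hu : u = x
  · subst hu
    rw [Finset.sum_eq_single_of_mem v h (fun y _ hy => if_neg fun he => hy
      (Sym2.congr_right.1 he).symm)]
    simp [hne.symm]
  · by_cases hv : v = x
    · subst hv
      rw [Finset.sum_eq_single_of_mem u h.symm (fun y _ hy => if_neg fun he => hy
        (Sym2.congr_right.1 (Sym2.eq_swap.trans he)).symm)]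
      simp [hu, Sym2.eq_swap]
    · simp only [hu, hv, if_false, add_zero]
      refine Finset.sum_eq_zero fun y _ => if_neg fun he => ?_
      rcases Sym2.eq_iff.1 he with h' | h'
      · exact hu h'.1
      · exact hv h'.2

/-- The edge chain of a walk. -/
def walkChain {u v : ℤ × ℤ} (w : squareGrid.Walk u v) (e : Sym2 (ℤ × ℤ)) : ZMod 2 :=
  (w.edges.count e : ZMod 2)

theorem gridBoundary_walkChain {u v : ℤ × ℤ} (w : squareGrid.Walk u v) (x : ℤ × ℤ) :
    gridBoundary (walkChain w) x = (if u = x then 1 else 0) + if v = x then 1 else 0 := by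
  induction w with
  | nil => simp [gridBoundary, walkChain, CharTwo.add_self_eq_zero]
  | @cons u m v h w ih =>
    have : ∀ e, walkChain (.cons h w) e = (if s(u, m) = e then 1 else 0) + walkChain w e := by
      intro e
      rw [walkChain, walkChain, SimpleGraph.Walk.edges_cons, List.count_cons, add_comm]
      simp
    have hs : gridBoundary (walkChain (.cons h w)) x =
        gridBoundary (fun e => if s(u, m) = e then 1 else 0) x + gridBoundary (walkChain w) x := by
      simp only [gridBoundary, this, Finset.sum_add_distrib]
    rw [hs, gridBoundary_edge h, ih]
    have := CharTwo.add_self_eq_zero (if m = x then (1 : ZMod 2) else 0)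
    linear_combination this

/-! ### Grid minors and the duality between cycles and face cuts. -/

/-- A model of the graph with edge ends `a e` and `b e` as a minor of the square grid: disjoint
finite connected branch sets, and an edge of the grid for every edge of the graph. -/
structure GridMinor {V E : Type*} (a b : E → V) where
  /-- the branch sets -/
  branch : V → Set (ℤ × ℤ)
  finite : ∀ v, (branch v).Finite
  eq_of_mem : ∀ u v x, x ∈ branch u → x ∈ branch v → u = v
  /-- a point of each branch set -/
  root : V → ℤ × ℤ
  connected : ∀ v, ∀ x ∈ branch v, ∃ w : squareGrid.Walk (root v) x, ∀ y ∈ w.support, y ∈ branch v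
  root_mem : ∀ v, root v ∈ branch v
  /-- the end in `branch (a e)` of the edge that represents `e` -/
  p : E → ℤ × ℤ
  /-- the end in `branch (b e)` of the edge that represents `e` -/
  q : E → ℤ × ℤ
  p_mem : ∀ e, p e ∈ branch (a e)
  q_mem : ∀ e, q e ∈ branch (b e)
  adj : ∀ e, squareGrid.Adj (p e) (q e)

/-- A symmetric sum with zero diagonal vanishes in characteristic two. -/
theorem sum_sum_eq_zero_of_comm {ι : Type*} (B : Finset ι) (φ : ι → ι → ZMod 2)
    (hφ : ∀ x y, φ x y = φ y x) (h₀ : ∀ x, φ x x = 0) : ∑ x ∈ B, ∑ y ∈ B, φ x y = 0 := by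
  classical
  rw [← Finset.sum_product']
  refine Finset.sum_involution (fun p _ => p.swap) (fun p _ => ?_) (fun p _ hp he => hp ?_)
    (fun p hp => ?_) (fun p _ => p.swap_swap)
  · rw [Prod.fst_swap, Prod.snd_swap, hφ p.2, CharTwo.add_self_eq_zero]
  · rw [← congrArg Prod.fst he, Prod.fst_swap, h₀]
  · simp only [Finset.mem_product, Prod.fst_swap, Prod.snd_swap] at hp ⊢
    exact hp.symm

namespace GridMinor

variable {V E : Type*} {a b : E → V} (M : GridMinor a b)

/-- Both ends of an edge of the grid are in the same branch set. -/
def Inside (x y : ℤ × ℤ) : Prop := ∃ v, x ∈ M.branch v ∧ y ∈ M.branch v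

/-- Two cells are on the two sides of an edge of the grid that is not used by the model. -/
def CellRel (k l : ℤ × ℤ) : Prop := ∃ x y, squareGrid.Adj x y ∧ ¬ M.Inside x y ∧
  (∀ e, s(M.p e, M.q e) ≠ s(x, y)) ∧ k = leftCell x y ∧ l = rightCell x y

/-- The faces of the model. -/
def Face : Type := Quot M.CellRel

/-- The face on one side of an edge. -/
def leftFace (e : E) : M.Face := Quot.mk _ (leftCell (M.p e) (M.q e))

/-- The face on the other side of an edge. -/
def rightFace (e : E) : M.Face := Quot.mk _ (rightCell (M.p e) (M.q e))

theorem cellDiff_eq_zero (g : M.Face → ZMod 2) {x y : ℤ × ℤ} (h : squareGrid.Adj x y)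
    (h₁ : ¬ M.Inside x y) (h₂ : ∀ e, s(M.p e, M.q e) ≠ s(x, y)) :
    cellDiff (fun k => g (Quot.mk _ k)) x y = 0 := by
  have : (Quot.mk M.CellRel (leftCell x y)) = Quot.mk _ (rightCell x y) :=
    Quot.sound ⟨x, y, h, h₁, h₂, rfl, rfl⟩
  rw [cellDiff, this, CharTwo.add_self_eq_zero]

/-- A walk between roots through the edge that represents an edge of the graph. -/
theorem exists_walkChain (e : E) : ∃ w : squareGrid.Walk (M.root (a e)) (M.root (b e)),
    ∀ x y, ¬ M.Inside x y → walkChain w s(x, y) = if s(M.p e, M.q e) = s(x, y) then 1 else 0 := by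
  obtain ⟨w₁, hw₁⟩ := M.connected _ _ (M.p_mem e)
  obtain ⟨w₂, hw₂⟩ := M.connected _ _ (M.q_mem e)
  refine ⟨w₁.append (.cons (M.adj e) w₂.reverse), fun x y hxy => ?_⟩
  have h₁ : s(x, y) ∉ w₁.edges := fun h => hxy ⟨_, hw₁ _ (w₁.fst_mem_support_of_mem_edges h),
    hw₁ _ (w₁.snd_mem_support_of_mem_edges h)⟩
  have h₂ : s(x, y) ∉ w₂.edges := fun h => hxy ⟨_, hw₂ _ (w₂.fst_mem_support_of_mem_edges h),
    hw₂ _ (w₂.snd_mem_support_of_mem_edges h)⟩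
  rw [walkChain, SimpleGraph.Walk.edges_append, SimpleGraph.Walk.edges_cons,
    SimpleGraph.Walk.edges_reverse, List.count_append, List.count_cons,
    List.count_eq_zero_of_not_mem h₁, List.count_reverse, List.count_eq_zero_of_not_mem h₂]
  simp

variable (hab : ∀ e, a e ≠ b e)

include hab in
theorem not_inside (e : E) : ¬ M.Inside (M.p e) (M.q e) := fun ⟨_, h₁, h₂⟩ =>
  hab e ((M.eq_of_mem _ _ _ (M.p_mem e) h₁).trans (M.eq_of_mem _ _ _ (M.q_mem e) h₂).symm)

variable (hinj : Function.Injective fun e => s(a e, b e))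

include hinj in
theorem edge_injective {e e' : E} (h : s(M.p e, M.q e) = s(M.p e', M.q e')) : e = e' := by
  refine hinj (Sym2.eq_iff.2 ?_)
  have hp := M.p_mem e
  have hq := M.q_mem e
  rcases Sym2.eq_iff.1 h with ⟨h₁, h₂⟩ | ⟨h₁, h₂⟩
  · exact .inl ⟨M.eq_of_mem _ _ _ (h₁ ▸ hp) (M.p_mem e'), M.eq_of_mem _ _ _ (h₂ ▸ hq) (M.q_mem e')⟩
  · exact .inr ⟨M.eq_of_mem _ _ _ (h₁ ▸ hp) (M.q_mem e'), M.eq_of_mem _ _ _ (h₂ ▸ hq) (M.p_mem e')⟩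

variable [Fintype E] [DecidableEq V]

-- Cuts of faces are cycles: sum `cellDiff` over all grid edges at points of the branch set of `v`.
-- The total vanishes pointwise; edges with both ends in the branch set are counted twice, and
-- unused leaving edges have the same face on both sides. What remains is the boundary at `v`.
include hab hinj in
theorem edgeBoundary_faces (g : M.Face → ZMod 2) :
    edgeBoundary a b (fun e => g (M.leftFace e) + g (M.rightFace e)) = 0 := by
  classical
  ext v
  set f : ℤ × ℤ → ZMod 2 := fun k => g (Quot.mk _ k)
  set B := (M.finite v).toFinset
  have hmem : ∀ x, x ∈ B ↔ x ∈ M.branch v := fun x => (M.finite v).mem_toFinset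
  have hsum : ∑ x ∈ B, ∑ y ∈ gridNeighbors x, cellDiff f x y = 0 :=
    Finset.sum_eq_zero fun x _ => sum_cellDiff f x
  have hin : ∑ x ∈ B, ∑ y ∈ gridNeighbors x, (if y ∈ B then cellDiff f x y else 0) = 0 := by
    refine (Finset.sum_congr rfl fun x _ => ?_).trans (sum_sum_eq_zero_of_comm B
      (fun x y => if squareGrid.Adj x y then cellDiff f x y else 0)
      (fun x y => by simp only [squareGrid.adj_comm x y, cellDiff_comm f x y])
      (fun x => if_neg (squareGrid.irrefl)))
    rw [← Finset.sum_filter, ← Finset.sum_filter]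
    refine Finset.sum_congr ?_ fun _ _ => rfl
    ext y
    rw [Finset.mem_filter, Finset.mem_filter, squareGrid_adj, and_comm]
  have hout : ∀ x ∈ B, ∀ y ∈ gridNeighbors x, (if y ∈ B then 0 else cellDiff f x y) =
      ∑ e, ((if a e = v then if M.p e = x ∧ M.q e = y then cellDiff f (M.p e) (M.q e) else 0
        else 0) +
        if b e = v then if M.q e = x ∧ M.p e = y then cellDiff f (M.p e) (M.q e) else 0 else 0) := by
    intro x hx y hy
    by_cases he : ∃ e, s(M.p e, M.q e) = s(x, y)
    · obtain ⟨e, he⟩ := he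
      rw [Finset.sum_eq_single e]
      · rcases Sym2.eq_iff.1 he with ⟨rfl, rfl⟩ | ⟨rfl, rfl⟩
        · have hav : a e = v := M.eq_of_mem _ _ _ (M.p_mem e) ((hmem _).1 hx)
          have hy' : M.q e ∉ B := fun h => hab e (hav.trans
            (M.eq_of_mem _ _ _ (M.q_mem e) ((hmem _).1 h)).symm)
          have : b e ≠ v := fun h => hab e (hav.trans h.symm)
          simp [hav, hy', this]
        · have hbv : b e = v := M.eq_of_mem _ _ _ (M.q_mem e) ((hmem _).1 hx)
          have hy' : M.p e ∉ B := fun h => hab e ((M.eq_of_mem _ _ _ (M.p_mem e)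
            ((hmem _).1 h)).trans hbv.symm)
          have : a e ≠ v := fun h => hab e (h.trans hbv.symm)
          simp [hbv, hy', this, cellDiff_comm f (M.q e)]
      · intro e' _ hne
        have h₁ : ¬ (M.p e' = x ∧ M.q e' = y) := fun h => hne (M.edge_injective hinj
          (by rw [h.1, h.2, he]))
        have h₂ : ¬ (M.q e' = x ∧ M.p e' = y) := fun h => hne (M.edge_injective hinj
          (by rw [h.1, h.2, he, Sym2.eq_swap]))
        simp [h₁, h₂]
      · simp
    · push Not at he
      rw [Finset.sum_eq_zero]
      · split_ifs with hyB
        · rfl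
        · refine M.cellDiff_eq_zero g hy (fun ⟨u, hu, hu'⟩ => hyB ?_) he
          rwa [hmem, ← M.eq_of_mem _ _ _ hu ((hmem _).1 hx)]
      · intro e _
        have h₁ : ¬ (M.p e = x ∧ M.q e = y) := fun h => he e (by rw [h.1, h.2])
        have h₂ : ¬ (M.q e = x ∧ M.p e = y) := fun h => he e (by rw [h.1, h.2, Sym2.eq_swap])
        simp [h₁, h₂]
  have hsplit : ∑ x ∈ B, ∑ y ∈ gridNeighbors x, (if y ∈ B then 0 else cellDiff f x y) = 0 := by
    refine Eq.trans ?_ hsum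
    refine (zero_add _).symm.trans ?_
    refine (congrArg (· + _) hin.symm).trans ?_
    rw [← Finset.sum_add_distrib]
    refine Finset.sum_congr rfl fun x _ => ?_
    rw [← Finset.sum_add_distrib]
    refine Finset.sum_congr rfl fun y _ => ?_
    split_ifs <;> simp
  refine Eq.trans ?_ hsplit
  rw [edgeBoundary_apply,
    Finset.sum_congr rfl fun x hx => Finset.sum_congr rfl (hout x hx),
    Finset.sum_congr rfl fun x _ => Finset.sum_comm, Finset.sum_comm]
  refine Finset.sum_congr rfl fun e _ => ?_
  have hcount : ∀ x₀ y₀ : ℤ × ℤ, ∀ k : ZMod 2, x₀ ∈ B → y₀ ∈ gridNeighbors x₀ →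
      ∑ x ∈ B, ∑ y ∈ gridNeighbors x, (if x₀ = x ∧ y₀ = y then k else 0) = k := by
    intro x₀ y₀ k hx₀ hy₀
    rw [Finset.sum_eq_single_of_mem x₀ hx₀ (fun x _ hx => Finset.sum_eq_zero fun y _ =>
      if_neg fun h => hx h.1.symm), Finset.sum_eq_single_of_mem y₀ hy₀
      (fun y _ hy => if_neg fun h => hy h.2.symm), if_pos ⟨rfl, rfl⟩]
  simp only [Finset.sum_add_distrib]
  congr 1
  · by_cases hav : a e = v
    · simp only [hav, if_true]
      rw [hcount _ _ _ ((hmem _).2 (hav ▸ M.p_mem e)) (M.adj e)]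
      rfl
    · simp [hav]
  · by_cases hbv : b e = v
    · simp only [hbv, if_true]
      rw [hcount _ _ _ ((hmem _).2 (hbv ▸ M.q_mem e)) (M.adj e).symm]
      rfl
    · simp [hbv]

-- Cycles are cuts of faces: replace each edge by a grid walk between roots. The resulting chain is
-- closed, hence the coboundary of a function on cells. It vanishes on the edges across which cells
-- are glued, so the function descends to faces, and its value on the grid edge representing `e` is
-- `z e`.
include hab hinj in
theorem exists_faces_of_edgeBoundary (z : E → ZMod 2) (hz : edgeBoundary a b z = 0) :
    ∃ g : M.Face → ZMod 2, ∀ e, z e = g (M.leftFace e) + g (M.rightFace e) := by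
  choose w hw using M.exists_walkChain
  set c : Sym2 (ℤ × ℤ) → ZMod 2 := fun ε => ∑ e, z e * walkChain (w e) ε with hc
  have hroot : ∀ u v, M.root u = M.root v ↔ u = v := fun u v =>
    ⟨fun h => M.eq_of_mem _ _ _ (M.root_mem u) (h ▸ M.root_mem v), fun h => h ▸ rfl⟩
  have hbd : ∀ x, gridBoundary c x = 0 := by
    intro x
    have h₁ : gridBoundary c x = ∑ e, z e * gridBoundary (walkChain (w e)) x := by
      simp only [gridBoundary, hc, Finset.mul_sum]
      rw [Finset.sum_comm]
    simp only [h₁, gridBoundary_walkChain]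
    by_cases hx : ∃ v, M.root v = x
    · obtain ⟨v, rfl⟩ := hx
      refine Eq.trans ?_ (congrFun hz v)
      rw [edgeBoundary_apply]
      refine Finset.sum_congr rfl fun e _ => ?_
      simp only [hroot, mul_add, mul_ite, mul_one, mul_zero]
    · push Not at hx
      simp [hx]
  obtain ⟨f, hf⟩ := exists_cellDiff_of_gridBoundary c hbd
  refine ⟨Quot.lift f ?_, fun e => ?_⟩
  · rintro _ _ ⟨x, y, hxy, h₁, h₂, rfl, rfl⟩
    have h := hf x y hxy
    have h₀ : c s(x, y) = 0 := by
      rw [hc]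
      exact Finset.sum_eq_zero fun e _ => by rw [hw e x y h₁, if_neg (h₂ e), mul_zero]
    rw [h₀, cellDiff] at h
    exact CharTwo.add_eq_zero.1 h.symm
  · have h := hf _ _ (M.adj e)
    have h₀ : c s(M.p e, M.q e) = z e := by
      rw [hc]
      dsimp only
      rw [Finset.sum_eq_single e]
      · rw [hw e _ _ (M.not_inside hab e), if_pos rfl, mul_one]
      · intro e' _ hne
        rw [hw e' _ _ (M.not_inside hab e), if_neg fun h => hne (M.edge_injective hinj h),
          mul_zero]
      · simp
    rw [← h₀, h]
    rfl

end GridMinor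

theorem three_mul_card_add_four_le_of_gridMinor {V E : Type*} [Fintype V] [Nonempty V] [Fintype E]
    {a b : E → V} (M : GridMinor a b) (G : SimpleGraph V) (hG : 8 ≤ G.egirth)
    (hab : ∀ e, G.Adj (a e) (b e)) (hinj : Function.Injective fun e => s(a e, b e)) :
    3 * Fintype.card E + 4 ≤ 4 * Fintype.card V := by
  classical
  refine three_mul_card_add_four_le_of_dual a b G hG hab hinj M.leftFace M.rightFace fun z =>
    ⟨M.exists_faces_of_edgeBoundary (fun e => (hab e).ne) hinj z, ?_⟩
  rintro ⟨g, hg⟩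
  rw [funext hg]
  exact M.edgeBoundary_faces (fun e => (hab e).ne) hinj g

/-! ### Approximation of plane paths by grid walks. -/

open Topology Filter

/-- The cell of the square grid with mesh `ε` that contains a point. -/
noncomputable def cellOf (ε : ℝ) (p : ℝ × ℝ) : ℤ × ℤ := (⌊p.1 / ε⌋, ⌊p.2 / ε⌋)

/-- A point of the square grid, scaled by `ε`. -/
def gridPoint (ε : ℝ) (x : ℤ × ℤ) : ℝ × ℝ := (ε * x.1, ε * x.2)

theorem abs_mul_floor_sub_le {ε : ℝ} (hε : 0 < ε) (p : ℝ) : |ε * ⌊p / ε⌋ - p| ≤ ε := by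
  have h₁ := Int.floor_le (p / ε)
  have h₂ := Int.lt_floor_add_one (p / ε)
  rw [le_div_iff₀ hε] at h₁
  rw [div_lt_iff₀ hε] at h₂
  rw [abs_le]
  constructor <;> nlinarith

theorem dist_gridPoint_cellOf {ε : ℝ} (hε : 0 < ε) (p : ℝ × ℝ) :
    dist (gridPoint ε (cellOf ε p)) p ≤ ε :=
  max_le (abs_mul_floor_sub_le hε p.1) (abs_mul_floor_sub_le hε p.2)

theorem cellOf_gridPoint {ε : ℝ} (hε : 0 < ε) (x : ℤ × ℤ) : cellOf ε (gridPoint ε x) = x := by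
  simp [cellOf, gridPoint, mul_div_cancel_left₀ _ hε.ne']

theorem abs_floor_sub_floor_le {ε : ℝ} (hε : 0 < ε) {p q : ℝ} (h : |p - q| < ε) :
    |⌊p / ε⌋ - ⌊q / ε⌋| ≤ 1 := by
  have h₁ := Int.floor_le (p / ε)
  have h₂ := Int.lt_floor_add_one (p / ε)
  have h₃ := Int.floor_le (q / ε)
  have h₄ := Int.lt_floor_add_one (q / ε)
  have h₅ : |p / ε - q / ε| < 1 := by
    rw [← sub_div, abs_div, abs_of_pos hε, div_lt_one hε]
    exact h
  rw [abs_lt] at h₅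
  have h₆ : (⌊p / ε⌋ : ℝ) < ⌊q / ε⌋ + 2 := by linarith
  have h₇ : (⌊q / ε⌋ : ℝ) < ⌊p / ε⌋ + 2 := by linarith
  norm_cast at h₆ h₇
  rw [abs_le]
  omega

theorem exists_walk_horizontal {i k : ℤ} (h : |i - k| ≤ 1) (j : ℤ) :
    ∃ w : squareGrid.Walk (i, j) (k, j), ∀ x ∈ w.support, (x.1 = i ∨ x.1 = k) ∧ x.2 = j := by
  rw [abs_le] at h
  by_cases hik : i = k
  · subst hik
    exact ⟨.nil, by simp⟩
  · refine ⟨.cons (squareGrid_adj.2 (mem_gridNeighbors.2 ?_)) .nil, by simp⟩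
    dsimp only
    omega

theorem exists_walk_vertical {j l : ℤ} (h : |j - l| ≤ 1) (i : ℤ) :
    ∃ w : squareGrid.Walk (i, j) (i, l), ∀ x ∈ w.support, x.1 = i ∧ (x.2 = j ∨ x.2 = l) := by
  rw [abs_le] at h
  by_cases hjl : j = l
  · subst hjl
    exact ⟨.nil, by simp⟩
  · refine ⟨.cons (squareGrid_adj.2 (mem_gridNeighbors.2 ?_)) .nil, by simp⟩
    dsimp only
    omega

/-- The distance on `ℝ × ℝ` is the maximum of the coordinate distances, so the cell indices differ
by at most 1 in each coordinate and one horizontal and one vertical step suffice. -/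
theorem exists_walk_of_dist_lt {ε : ℝ} (hε : 0 < ε) {p q : ℝ × ℝ} (h : dist p q < ε) :
    ∃ w : squareGrid.Walk (cellOf ε p) (cellOf ε q),
      ∀ x ∈ w.support, dist (gridPoint ε x) p ≤ 2 * ε := by
  obtain ⟨h₁, h₂⟩ := max_lt_iff.1 h
  obtain ⟨w₁, hw₁⟩ := exists_walk_horizontal (abs_floor_sub_floor_le hε h₁) ⌊p.2 / ε⌋
  obtain ⟨w₂, hw₂⟩ := exists_walk_vertical (abs_floor_sub_floor_le hε h₂) ⌊q.1 / ε⌋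
  have key : ∀ {a b : ℝ}, |a - b| < ε → ∀ m : ℤ, m = ⌊a / ε⌋ ∨ m = ⌊b / ε⌋ →
      |ε * m - a| ≤ 2 * ε := by
    rintro a b hab m (rfl | rfl)
    · linarith [abs_mul_floor_sub_le hε a]
    · have := abs_sub_le (ε * ⌊b / ε⌋) b a
      rw [abs_sub_comm b a] at this
      linarith [abs_mul_floor_sub_le hε b]
  refine ⟨w₁.append w₂, fun x hx => ?_⟩
  rcases (SimpleGraph.Walk.mem_support_append_iff _ _).1 hx with hx | hx
  · exact max_le (key h₁ _ (hw₁ x hx).1) (key h₂ _ (.inl (hw₁ x hx).2))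
  · exact max_le (key h₁ _ (.inr (hw₂ x hx).1)) (key h₂ _ (hw₂ x hx).2)

/-- A path in the plane is accompanied by a walk in the square grid. -/
theorem exists_walk_of_path {ε : ℝ} (hε : 0 < ε) {p q : ℝ × ℝ} (γ : Path p q) :
    ∃ w : squareGrid.Walk (cellOf ε p) (cellOf ε q),
      ∀ x ∈ w.support, ∃ t, dist (gridPoint ε x) (γ t) ≤ 2 * ε := by
  -- Connectedness of the interval replaces a subdivision: being joined by an accompanying walk
  -- holds for nearby parameters and is transitive.
  have h := PreconnectedSpace.induction₂' (fun s t : unitInterval =>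
    ∃ w : squareGrid.Walk (cellOf ε (γ s)) (cellOf ε (γ t)),
      ∀ x ∈ w.support, ∃ u, dist (gridPoint ε x) (γ u) ≤ 2 * ε) (fun s => ?_) ⟨?_⟩ 0 1
  · rwa [γ.source, γ.target] at h
  · filter_upwards [(γ.continuous.tendsto s).eventually (Metric.ball_mem_nhds _ hε)] with t ht
    obtain ⟨w, hw⟩ := exists_walk_of_dist_lt hε ht
    exact ⟨⟨w.reverse, fun x hx => ⟨t, hw x (by simpa using hx)⟩⟩, ⟨w, fun x hx => ⟨t, hw x hx⟩⟩⟩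
  · rintro s t u ⟨w, hw⟩ ⟨w', hw'⟩
    refine ⟨w.append w', fun x hx => ?_⟩
    rcases (SimpleGraph.Walk.mem_support_append_iff _ _).1 hx with hx | hx
    · exact hw x hx
    · exact hw' x hx

/-- The walk accompanies a straight segment, which stays in the ball by convexity. -/
theorem exists_walk_of_dist_le {ε r : ℝ} (hε : 0 < ε) {p : ℝ × ℝ} {x : ℤ × ℤ}
    (h : dist (gridPoint ε x) p ≤ r) : ∃ w : squareGrid.Walk (cellOf ε p) x,
      ∀ y ∈ w.support, dist (gridPoint ε y) p ≤ r + 2 * ε := by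
  have hw := exists_walk_of_path hε (Path.segment p (gridPoint ε x))
  rw [cellOf_gridPoint hε] at hw
  obtain ⟨w, hw⟩ := hw
  refine ⟨w, fun y hy => ?_⟩
  obtain ⟨t, ht⟩ := hw y hy
  have hr : Path.segment p (gridPoint ε x) t ∈ Metric.closedBall p r :=
    (convex_closedBall p r).segment_subset
      (Metric.mem_closedBall_self (dist_nonneg.trans h)) h
      (Path.range_segment p (gridPoint ε x) ▸ Set.mem_range_self t)
  linarith [dist_triangle (gridPoint ε y) (Path.segment p (gridPoint ε x) t) p,
    Metric.mem_closedBall.1 hr]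

theorem finite_dist_gridPoint_le {ε : ℝ} (hε : 0 < ε) (p : ℝ × ℝ) (r : ℝ) :
    {x | dist (gridPoint ε x) p ≤ r}.Finite := by
  refine (Set.finite_Icc ((⌈(p.1 - r) / ε⌉, ⌈(p.2 - r) / ε⌉) : ℤ × ℤ)
    (⌊(p.1 + r) / ε⌋, ⌊(p.2 + r) / ε⌋)).subset fun x hx => ?_
  obtain ⟨h₁, h₂⟩ := max_le_iff.1
    (show max |ε * x.1 - p.1| |ε * x.2 - p.2| ≤ r from hx)
  have h₁' := abs_le.1 h₁
  have h₂' := abs_le.1 h₂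
  refine ⟨⟨?_, ?_⟩, ⟨?_, ?_⟩⟩ <;> dsimp only
  · rw [Int.ceil_le, div_le_iff₀ hε]
    linarith
  · rw [Int.ceil_le, div_le_iff₀ hε]
    linarith
  · rw [Int.le_floor, le_div_iff₀ hε]
    linarith
  · rw [Int.le_floor, le_div_iff₀ hε]
    linarith

/-- The part of a walk before its first vertex in `S`. -/
theorem SimpleGraph.Walk.exists_prefix {V : Type*} {G : SimpleGraph V} {u v : V} (w : G.Walk u v)
    (S : Set V) (hu : u ∉ S) (hv : v ∈ S) : ∃ (x y : V) (p : G.Walk u x), G.Adj x y ∧ y ∈ S ∧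
      ∀ z ∈ p.support, z ∉ S ∧ z ∈ w.support := by
  induction w with
  | nil => exact (hu hv).elim
  | @cons u m v h w ih =>
    by_cases hm : m ∈ S
    · exact ⟨u, m, .nil, h, hm, by simpa using hu⟩
    · obtain ⟨x, y, p, hxy, hy, hp⟩ := ih hm hv
      refine ⟨x, y, .cons h p, hxy, hy, fun z hz => ?_⟩
      rw [support_cons, List.mem_cons] at hz ⊢
      rcases hz with rfl | hz
      · exact ⟨hu, .inl rfl⟩
      · exact ⟨(hp z hz).1, .inr (hp z hz).2⟩

theorem eventually_mul_le {m : ℝ} (hm : 0 < m) : ∀ᶠ δ in 𝓝[>] (0 : ℝ), 8 * δ ≤ m := by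
  filter_upwards [Ioo_mem_nhdsGT (show (0 : ℝ) < m / 8 by positivity)] with δ hδ
  linarith [hδ.2]

/-! ### From plane drawings to grid minors. -/

namespace PlaneDrawing

variable {V : Type*} {G : SimpleGraph V} (D : PlaneDrawing G)

/-- The drawing of an induced subgraph. -/
def induce (s : Set V) : PlaneDrawing (G.induce s) where
  point v := D.point v
  arc d := D.arc ((SimpleGraph.Embedding.induce s).toHom.mapDart d)
  point_injective := D.point_injective.comp Subtype.val_injective
  arc_injective _ := D.arc_injective _
  arc_symm d := D.arc_symm ((SimpleGraph.Embedding.induce s).toHom.mapDart d)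
  arc_ne_point _ t h₀ h₁ v := D.arc_ne_point _ t h₀ h₁ v
  arc_ne_arc _ _ h := D.arc_ne_arc _ _ fun he => h
    (Sym2.map.injective Subtype.val_injective he)

theorem arc_ne_point_of_ne (d : G.Dart) (v : V) (h₁ : v ≠ d.fst) (h₂ : v ≠ d.snd)
    (t : unitInterval) : D.arc d t ≠ D.point v := by
  by_cases ht₀ : t = 0
  · rw [ht₀, Path.source]
    exact fun h => h₁ (D.point_injective h).symm
  · by_cases ht₁ : t = 1
    · rw [ht₁, Path.target]
      exact fun h => h₂ (D.point_injective h).symm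
    · exact D.arc_ne_point d t ht₀ ht₁ v

/-- The points of a drawing are far from each other and from the arcs not ending there. -/
theorem eventually_points [Finite V] : ∀ᶠ η in 𝓝[>] (0 : ℝ),
    (∀ u v, u ≠ v → 8 * η ≤ dist (D.point u) (D.point v)) ∧
    ∀ (d : G.Dart) v, v ≠ d.fst → v ≠ d.snd → ∀ t, 8 * η ≤ dist (D.arc d t) (D.point v) := by
  have : Finite G.Dart := Finite.of_injective _ SimpleGraph.Dart.toProd_injective
  refine Filter.Eventually.and ?_ ?_
  · refine eventually_all.2 fun u => eventually_all.2 fun v => eventually_imp_distrib_left.2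
      fun h => eventually_mul_le (dist_pos.2 fun h' => h (D.point_injective h'))
  · refine eventually_all.2 fun d => eventually_all.2 fun v => eventually_imp_distrib_left.2
      fun h₁ => eventually_imp_distrib_left.2 fun h₂ => ?_
    obtain ⟨m, hm, hm'⟩ := isCompact_univ.exists_forall_le'
      (f := fun t => dist (D.arc d t) (D.point v)) (a := 0)
      ((D.arc d).continuous.dist continuous_const).continuousOn
      (fun t _ => dist_pos.2 (D.arc_ne_point_of_ne d v h₁ h₂ t))
    exact (eventually_mul_le hm).mono fun η h t => h.trans (hm' t trivial)

/-- Away from the points of a drawing, its arcs are far from each other. -/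
theorem eventually_arcs [Finite V] {η : ℝ} (hη : 0 < η) : ∀ᶠ ε in 𝓝[>] (0 : ℝ),
    ∀ d d' : G.Dart, d.edge ≠ d'.edge → ∀ s t, (∀ v, η ≤ dist (D.arc d s) (D.point v)) →
      (∀ v, η ≤ dist (D.arc d' t) (D.point v)) → 8 * ε ≤ dist (D.arc d s) (D.arc d' t) := by
  have : Finite G.Dart := Finite.of_injective _ SimpleGraph.Dart.toProd_injective
  refine eventually_all.2 fun d => eventually_all.2 fun d' => eventually_imp_distrib_left.2
      fun hd => ?_
  have hfar : ∀ (d : G.Dart) t, (∀ v, η ≤ dist (D.arc d t) (D.point v)) → t ≠ 0 ∧ t ≠ 1 := by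
    refine fun d t h => ⟨?_, ?_⟩ <;> rintro rfl
    · have := h d.fst
      rw [Path.source, dist_self] at this
      linarith
    · have := h d.snd
      rw [Path.target, dist_self] at this
      linarith
  have hcl : ∀ d : G.Dart, IsClosed {t | ∀ v, η ≤ dist (D.arc d t) (D.point v)} := fun d => by
    simp only [Set.ofPred_forall]
    exact isClosed_iInter fun v =>
      isClosed_le continuous_const ((D.arc d).continuous.dist continuous_const)
  obtain ⟨m, hm, hm'⟩ := ((hcl d).prod (hcl d')).isCompact.exists_forall_le'
    (f := fun p => dist (D.arc d p.1) (D.arc d' p.2)) (a := 0)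
    (((D.arc d).continuous.comp continuous_fst).dist
      ((D.arc d').continuous.comp continuous_snd)).continuousOn
    (fun p hp => dist_pos.2 (D.arc_ne_arc d d' hd _ _ (hfar d _ hp.1).1 (hfar d _ hp.1).2
      (hfar d' _ hp.2).1 (hfar d' _ hp.2).2))
  exact (eventually_mul_le hm).mono fun ε h s t hs ht => h.trans (hm' (s, t) ⟨hs, ht⟩)

/-- A drawn graph is a minor of the square grid. -/
theorem nonempty_gridMinor (D : PlaneDrawing G) [Finite V] {E : Type*} [Finite E] (d : E → G.Dart)
    (hd : Function.Injective fun e => (d e).edge) :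
    Nonempty (GridMinor (fun e => (d e).fst) fun e => (d e).snd) := by
  classical
  -- Two scales: `η` separates points from each other and from foreign arcs; then `ε`, at most `η /
  -- 8`, separates arcs outside the `η`-balls around the points. The factor 8 leaves room for all
  -- approximation errors.
  obtain ⟨η, ⟨hpp, hpa⟩, hη⟩ := (D.eventually_points.and self_mem_nhdsWithin).exists
  replace hη : 0 < η := hη
  obtain ⟨ε, ⟨haa, hεη⟩, hε⟩ := (((D.eventually_arcs hη).and
    (eventually_mul_le hη)).and self_mem_nhdsWithin).exists
  replace hε : 0 < ε := hε
  set root : V → ℤ × ℤ := fun v => cellOf ε (D.point v)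
  -- The component of the root among the grid points within `3 * η` is used, so that connectedness
  -- is built in. It contains all grid points within `2 * η`.
  set B : V → Set (ℤ × ℤ) := fun v => {x | ∃ w : squareGrid.Walk (root v) x,
    ∀ y ∈ w.support, dist (gridPoint ε y) (D.point v) ≤ 3 * η}
  have hBdist : ∀ v, ∀ x ∈ B v, dist (gridPoint ε x) (D.point v) ≤ 3 * η := fun v x ⟨w, hw⟩ =>
    hw x w.end_mem_support
  have hBmem : ∀ v x, dist (gridPoint ε x) (D.point v) ≤ 2 * η → x ∈ B v := fun v x hx => by
    obtain ⟨w, hw⟩ := exists_walk_of_dist_le hε hx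
    exact ⟨w, fun y hy => (hw y hy).trans (by linarith)⟩
  have hBroot : ∀ v, root v ∈ B v := fun v => hBmem v _
    ((dist_gridPoint_cellOf hε _).trans (by linarith))
  have hBB : ∀ u v x, x ∈ B u → x ∈ B v → u = v := fun u v x hu hv => by
    by_contra huv
    linarith [hpp u v huv, hBdist u x hu, hBdist v x hv,
      dist_triangle_left (D.point u) (D.point v) (gridPoint ε x)]
  choose W hW using fun e => exists_walk_of_path hε (D.arc (d e))
  -- Each edge is cut just before its walk first meets the disc of its head. The initial part `P e`
  -- joins the branch set of the tail, and the step `x e`, `y e` represents the edge.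
  choose x y P hxy hy hP using fun e => (W e).exists_prefix (B (d e).snd)
    (fun h => (d e).adj.ne (hBB _ _ _ (hBroot _) h)) (hBroot _)
  have hPB : ∀ e, ∀ z ∈ (P e).support, ∀ v, z ∈ B v → v = (d e).fst := by
    intro e z hz v hv
    by_contra hne
    obtain ⟨t, ht⟩ := hW e z (hP e z hz).2
    have hne' : v ≠ (d e).snd := fun h => (hP e z hz).1 (h ▸ hv)
    linarith [hpa (d e) v hne hne' t, hBdist v z hv,
      dist_triangle_left (D.arc (d e) t) (D.point v) (gridPoint ε z)]
  have hPfar : ∀ e, ∀ z ∈ (P e).support, z ∉ B (d e).fst → ∃ t,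
      dist (gridPoint ε z) (D.arc (d e) t) ≤ 2 * ε ∧
      ∀ v, η ≤ dist (D.arc (d e) t) (D.point v) := by
    intro e z hz hzB
    obtain ⟨t, ht⟩ := hW e z (hP e z hz).2
    refine ⟨t, ht, fun v => ?_⟩
    by_contra! hlt
    have hv : z ∈ B v := hBmem v z (by
      linarith [dist_triangle (gridPoint ε z) (D.arc (d e) t) (D.point v)])
    exact hzB (hPB e z hz v hv ▸ hv)
  -- A common point lying in neither tail disc would be within `2 * ε` of points of two different
  -- arcs, both far from all vertices, contradicting the separation `8 * ε`.
  have hPP : ∀ e e' z, z ∈ (P e).support → z ∈ (P e').support → (d e).fst = (d e').fst := by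
    intro e e' z hz hz'
    by_cases hee : e = e'
    · rw [hee]
    by_cases h₁ : z ∈ B (d e).fst
    · exact hPB e' z hz' _ h₁
    by_cases h₂ : z ∈ B (d e').fst
    · exact (hPB e z hz _ h₂).symm
    obtain ⟨s, hs, hs'⟩ := hPfar e z hz h₁
    obtain ⟨t, ht, ht'⟩ := hPfar e' z hz' h₂
    linarith [haa (d e) (d e') (fun h => hee (hd h)) s t hs' ht',
      dist_triangle_left (D.arc (d e) s) (D.arc (d e') t) (gridPoint ε z)]
  exact ⟨{
    branch := fun v => B v ∪ ⋃ e, {z | (d e).fst = v ∧ z ∈ (P e).support}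
    finite := fun v => ((finite_dist_gridPoint_le hε (D.point v) (3 * η)).subset
      (hBdist v)).union (Set.finite_iUnion fun e =>
        ((P e).support.finite_toSet).subset fun z hz => hz.2)
    eq_of_mem := by
      intro u v z hu hv
      rcases hu with hu | hu <;> rcases hv with hv | hv
      · exact hBB u v z hu hv
      · obtain ⟨e, rfl, he⟩ := Set.mem_iUnion.1 hv
        exact hPB e z he u hu
      · obtain ⟨e, rfl, he⟩ := Set.mem_iUnion.1 hu
        exact (hPB e z he v hv).symm
      · obtain ⟨e, rfl, he⟩ := Set.mem_iUnion.1 hu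
        obtain ⟨e', rfl, he'⟩ := Set.mem_iUnion.1 hv
        exact hPP e e' z he he'
    root := root
    connected := by
      rintro v z (⟨w, hw⟩ | hz)
      · exact ⟨w, fun y hy => .inl ⟨w.takeUntil y hy, fun y' hy' =>
          hw y' (w.support_takeUntil_subset_support hy hy')⟩⟩
      · obtain ⟨e, rfl, he⟩ := Set.mem_iUnion.1 hz
        exact ⟨(P e).takeUntil z he, fun y hy => .inr (Set.mem_iUnion.2
          ⟨e, rfl, (P e).support_takeUntil_subset_support he hy⟩)⟩
    root_mem := fun v => .inl (hBroot v)
    p := x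
    q := y
    p_mem := fun e => .inr (Set.mem_iUnion.2 ⟨e, rfl, (P e).end_mem_support⟩)
    q_mem := fun e => .inl (hy e)
    adj := hxy }⟩

end PlaneDrawing

/-! ### The edge bound and the conclusion. -/

/-- A planar graph of girth at least `8` on `n > 0` vertices has at most `(4 n - 4) / 3` edges. -/
theorem IsPlanarGraph.three_mul_card_edges_add_four_le {V : Type*} [Fintype V] [Nonempty V]
    {G : SimpleGraph V} [DecidableRel G.Adj] (hG : IsPlanarGraph G) (hgirth : 8 ≤ G.egirth) :
    3 * G.edgeFinset.card + 4 ≤ 4 * Fintype.card V := by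
  obtain ⟨D⟩ := hG
  have hdart : ∀ e : G.edgeSet, ∃ d : G.Dart, d.edge = e := by
    rintro ⟨e, he⟩
    induction e with
    | _ u v => exact ⟨⟨(u, v), he⟩, rfl⟩
  choose d hd using hdart
  have hinj : Function.Injective fun e => (d e).edge := fun e e' h =>
    Subtype.ext (by rw [← hd e, ← hd e']; exact h)
  obtain ⟨M⟩ := D.nonempty_gridMinor d hinj
  rw [SimpleGraph.edgeFinset_card]
  exact three_mul_card_add_four_le_of_gridMinor M G hgirth (fun e => (d e).adj) hinj

theorem mainTheorem6 {V W : Type*} [Finite V] (G : SimpleGraph V)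
    (hplanar : IsPlanarGraph G) (hgirth : 8 ≤ G.egirth)
    (C : CorrespondenceCover G W) (hC : C.IsFold 3) :
    ∃ I J : Set W, C.IsColoring I ∧ C.IsColoring J ∧ Disjoint I J := by
  classical
  refine C.exists_disjoint_colorings hC fun s hs => ?_
  have := Fintype.ofFinite s
  have := hs.to_subtype
  obtain ⟨D⟩ := hplanar
  have h := IsPlanarGraph.three_mul_card_edges_add_four_le (G := G.induce s) ⟨D.induce s⟩
    (hgirth.trans (SimpleGraph.IsContained.egirth_le
      ⟨(SimpleGraph.Embedding.induce s).toCopy⟩))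
  exact reducibleConfig_of_card_edges_lt _ (by omega)
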